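/- \textbf{Proposition} (Regularity and singularity with respect to self-similar measures). Let $N\ge 2$ and, for $0\le i\le N-1$, let $A_i=\begin{pmatrix}a_i&b_i\\c_i&d_i\end{pmatrix}$ be real matrices with $d_i=1$, and put $g_i(x)=\dfrac{a_ix+b_i}{c_ix+d_i}$ for $x\in[0,1]$. Assume (A1) $g_0(0)=0$, $g_{N-1}(1)=1$, and $g_{i-1}(1)=g_i(0)$ for $1\le i\le N-1$; (A2) $a_id_i-b_ic_i>0$ for every $i$; (A3) $(a_id_i-b_ic_i)^{1/2}\le\min\{d_i,\,c_i+d_i\}$ for every $i$. Let $\varphi:[0,1]\to[0,1]$ be the continuous solution of de Rham's functional equation $$\varphi(x)=g_i(\varphi(Nx-i)),\qquad \tfrac{i}{N}\le x\le\tfrac{i+1}{N},\quad 0\le i\le N-1,$$ and let $\mu_\varphi$ be the probability measure on $[0,1]$ whose distribution function is $\varphi$. For $p_0,\dots,p_{N-1}\in(0,1)$ with $\sum_i p_i=1$, the $(p_0,\dots,p_{N-1})$-self-similar measure $\mu_{(p_0,\dots,p_{N-1})}$ is the probability measure $\mu$ on $[0,1]$ with $\mu=\sum_{i=0}^{N-1}p_i\,\mu\circ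 f_i^{-1}$, where $f_i(z)=(z+i)/N$. Assume $a_0<1$ and put $e_0:=c_0/(1-a_0)$. (i) Let $p_i\in(0,1)$, $0\le i\le N-1$, be such that for every $i$ $$a_i=\frac{p_i+e_0\sum_{j=0}^{i}p_j}{\bigl(1-\sum_{j=0}^{i-1}p_j\bigr)e_0+1},\qquad b_i=\frac{\sum_{j=0}^{i-1}p_j}{\bigl(1-\sum_{j=0}^{i-1}p_j\bigr)e_0+1},\qquad c_i=\frac{e_0\Bigl(\bigl(1-\sum_{j=0}^{i}p_j\bigr)e_0+1-p_i\Bigr)}{\bigl(1-\sum_{j=0}^{i-1}p_j\bigr)e_0+1}.$$ Then $\sum_i p_i=1$, and $\mu_\varphi$ is absolutely continuous with respect to $\mu_{(p_0,\dots,p_{N-1})}$. (ii) If there are no $p_0,\dots,p_{N-1}\in(0,1)$ for which these equations hold for every $i$, then $\mu_\varphi$ is singular with respect to the $(q_0,\dots,q_{N-1})$-self-similar measure for all $q_0,\dots,q_{N-1}\in(0,1)$ with $\sum_i q_i=1$. -/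

import Mathlib

open MeasureTheory Set

namespace DeRham

/-- The linear fractional transformation `z ↦ (a z + b) / (c z + d)` of a real `2 × 2` matrix. -/
noncomputable def linFrac (A : Matrix (Fin 2) (Fin 2) ℝ) (z : ℝ) : ℝ :=
  (A 0 0 * z + A 0 1) / (A 1 0 * z + A 1 1)

/-- The compatibility, orientation and weak contraction conditions on the
matrices `A_0, …, A_{N-1}`. -/
structure Admissible {N : ℕ} (A : Fin N → Matrix (Fin 2) (Fin 2) ℝ) : Prop where
  left_end : ∀ i : Fin N, (i : ℕ) = 0 → linFrac (A i) 0 = 0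
  right_end : ∀ i : Fin N, (i : ℕ) + 1 = N → linFrac (A i) 1 = 1
  junction : ∀ i j : Fin N, (j : ℕ) = i + 1 → linFrac (A i) 1 = linFrac (A j) 0
  det_pos : ∀ i, 0 < (A i).det
  sqrt_det_le : ∀ i, √((A i).det) ≤ min (A i 1 1) (A i 1 0 + A i 1 1)

/-- `φ : [0,1] → [0,1]` is a continuous solution of de Rham's functional equation
`φ(x) = g_i(φ(N x - i))` for `i / N ≤ x ≤ (i + 1) / N`, where `g_i = linFrac (A i)`.
Values of `φ` outside `[0,1]` are irrelevant. -/
structure IsSolution {N : ℕ} (A : Fin N → Matrix (Fin 2) (Fin 2) ℝ) (φ : ℝ → ℝ) : Prop where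
  mapsTo : MapsTo φ (Icc 0 1) (Icc 0 1)
  continuousOn : ContinuousOn φ (Icc 0 1)
  equation : ∀ i : Fin N, ∀ x ∈ Icc ((i : ℝ) / N) (((i : ℝ) + 1) / N),
    φ x = linFrac (A i) (φ (N * x - i))

/-- `μ` is the probability measure on `[0,1]` (seen as a measure on `ℝ` carried by `[0,1]`)
whose distribution function is `φ`. -/
structure HasDistributionFunction (μ : Measure ℝ) (φ : ℝ → ℝ) : Prop where
  isProbabilityMeasure : IsProbabilityMeasure μ
  carried : μ (Icc 0 1)ᶜ = 0
  apply_Iic : ∀ x ∈ Icc (0 : ℝ) 1, μ (Iic x) = ENNReal.ofReal (φ x)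

/-- `m` is the `(p_0, …, p_{N-1})`-self-similar measure on `[0,1]`: the probability measure with
`m = ∑ i, p_i • (m ∘ f_i⁻¹)` for the maps `f_i(z) = (z + i) / N`. -/
structure IsSelfSimilarMeasure {N : ℕ} (p : Fin N → ℝ) (m : Measure ℝ) : Prop where
  isProbabilityMeasure : IsProbabilityMeasure m
  carried : m (Icc 0 1)ᶜ = 0
  invariant : m = ∑ i : Fin N, ENNReal.ofReal (p i) • m.map (fun z : ℝ => (z + (i : ℝ)) / N)

/-- The number `e₀ = c₀ / (1 - a₀)`. -/
noncomputable def e₀ {N : ℕ} [NeZero N] (A : Fin N → Matrix (Fin 2) (Fin 2) ℝ) : ℝ :=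
  A 0 1 0 / (1 - A 0 0 0)

/-- The explicit form of `a_i, b_i, c_i` in terms of `p_0, …, p_{N-1}` and `e₀`. -/
def HasExplicitForm {N : ℕ} [NeZero N] (A : Fin N → Matrix (Fin 2) (Fin 2) ℝ)
    (p : Fin N → ℝ) : Prop :=
  ∀ i : Fin N,
    A i 0 0 = (p i + e₀ A * ∑ j ∈ Finset.Iic i, p j) /
      ((1 - ∑ j ∈ Finset.Iio i, p j) * e₀ A + 1) ∧
    A i 0 1 = (∑ j ∈ Finset.Iio i, p j) /
      ((1 - ∑ j ∈ Finset.Iio i, p j) * e₀ A + 1) ∧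
    A i 1 0 = (e₀ A * ((1 - ∑ j ∈ Finset.Iic i, p j) * e₀ A + 1 - p i)) /
      ((1 - ∑ j ∈ Finset.Iio i, p j) * e₀ A + 1)

end DeRham

-- The functions `normFrac r` linearise the maps `linFrac (A i)`: `normFrac r ∘ linFrac (A i)` is
-- affine in `normFrac (ratioMap (A i) r)`, with slope `branchProb (A i) r`
-- (`IsBranch.normFrac_linFrac`). Hence the `μφ`-mass of an `N`-adic cylinder is a product of branch
-- probabilities taken along a ratio that starts at `0`, where `normFrac` is the identity, and is
-- moved by the ratio maps (`wordProb`).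
--
-- The explicit form amounts to this: all ratio maps fix `e₀ A`, and `p i` is the branch probability
-- there (`Admissible.of_hasExplicitForm`, `Admissible.hasExplicitForm`). Then `normFrac (e₀ A) ∘ φ`
-- solves the self-affine equation of the distribution function of the self-similar measure, so the
-- two agree on `[0,1]`. Since `normFrac (e₀ A)` has a Lipschitz inverse, increments of `φ` are
-- dominated, which gives absolute continuity.
--
-- Without a common fixed point, the branch probabilities cannot match `q` at two consecutive steps.
-- The two-step Hellinger affinity is then bounded by some `θ < 1` on a bounded set of ratios stable
-- under the ratio maps (`Admissible.exists_affinity_two_le`, `Admissible.exists_mapsTo_ratioMap`),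
-- so affinities decay geometrically. Small affinity yields nearly disjoint carriers, and
-- Borel–Cantelli gives singularity.

namespace DeRham

-- Linearisation of a single branch.

/-- The linear fractional map fixing `0` and `1` whose denominator is proportional to `1 + r x`. -/
noncomputable def normFrac (r x : ℝ) : ℝ := (1 + r) * x / (1 + r * x)

/-- The action of a matrix on the ratio of the coefficients of the denominator. -/
noncomputable def ratioMap (A : Matrix (Fin 2) (Fin 2) ℝ) (r : ℝ) : ℝ :=
  (A 0 0 * r + A 1 0) / (A 0 1 * r + 1)

/-- The increment of `normFrac r` over the image of `[0,1]` under `linFrac A`. -/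
noncomputable def branchProb (A : Matrix (Fin 2) (Fin 2) ℝ) (r : ℝ) : ℝ :=
  normFrac r (linFrac A 1) - normFrac r (linFrac A 0)

/-- A normalised matrix whose linear fractional map is increasing from `[0,1]` into `[0,1]`. -/
structure IsBranch (A : Matrix (Fin 2) (Fin 2) ℝ) : Prop where
  d_eq : A 1 1 = 1
  det_pos : 0 < A 0 0 - A 0 1 * A 1 0
  c_pos : 0 < A 1 0 + 1
  b_nonneg : 0 ≤ A 0 1
  b_lt : A 0 1 < 1
  ab_pos : 0 < A 0 0 + A 0 1
  ab_le : A 0 0 + A 0 1 ≤ A 1 0 + 1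

lemma one_add_mul_pos {r x : ℝ} (hr : -1 < r) (hx : x ∈ Icc (0 : ℝ) 1) : 0 < 1 + r * x := by
  rcases eq_or_lt_of_le hx.1 with h | h
  · simp [← h]
  · nlinarith [hx.2]

@[simp] lemma normFrac_zero (r : ℝ) : normFrac r 0 = 0 := by simp [normFrac]

lemma normFrac_one {r : ℝ} (hr : -1 < r) : normFrac r 1 = 1 := by
  have : (1 + r : ℝ) ≠ 0 := by linarith
  simp [normFrac, this]

@[simp] lemma normFrac_ratio_zero (x : ℝ) : normFrac 0 x = x := by simp [normFrac]

lemma normFrac_sub {r x y : ℝ} (hr : -1 < r) (hx : x ∈ Icc (0 : ℝ) 1) (hy : y ∈ Icc (0 : ℝ) 1) :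
    normFrac r y - normFrac r x = (1 + r) * (y - x) / ((1 + r * x) * (1 + r * y)) := by
  have h1 := (one_add_mul_pos hr hx).ne'
  have h2 := (one_add_mul_pos hr hy).ne'
  unfold normFrac
  rw [div_sub_div _ _ h2 h1, mul_comm (1 + r * x)]
  congr 1
  ring

lemma normFrac_lt {r x y : ℝ} (hr : -1 < r) (hx : x ∈ Icc (0 : ℝ) 1) (hy : y ∈ Icc (0 : ℝ) 1)
    (hxy : x < y) : normFrac r x < normFrac r y := by
  rw [← sub_pos, normFrac_sub hr hx hy]
  have h1 := one_add_mul_pos hr hx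
  have h2 := one_add_mul_pos hr hy
  have : 0 < 1 + r := by linarith
  have : 0 < y - x := by linarith
  positivity

lemma normFrac_mono {r x y : ℝ} (hr : -1 < r) (hx : x ∈ Icc (0 : ℝ) 1) (hy : y ∈ Icc (0 : ℝ) 1)
    (hxy : x ≤ y) : normFrac r x ≤ normFrac r y := by
  rcases eq_or_lt_of_le hxy with rfl | h
  · exact le_rfl
  · exact (normFrac_lt hr hx hy h).le

lemma normFrac_mem {r x : ℝ} (hr : -1 < r) (hx : x ∈ Icc (0 : ℝ) 1) :
    normFrac r x ∈ Icc (0 : ℝ) 1 := by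
  constructor
  · simpa using normFrac_mono hr ⟨le_rfl, zero_le_one⟩ hx hx.1
  · simpa [normFrac_one hr] using normFrac_mono hr hx ⟨zero_le_one, le_rfl⟩ hx.2

/-- `normFrac r` has a Lipschitz inverse on `[0,1]`. -/
lemma sub_le_mul_normFrac_sub {r x y : ℝ} (hr : -1 < r) (hx : x ∈ Icc (0 : ℝ) 1)
    (hy : y ∈ Icc (0 : ℝ) 1) (hxy : x ≤ y) :
    y - x ≤ (1 + |r|) ^ 2 / (1 + r) * (normFrac r y - normFrac r x) := by
  have h1 := one_add_mul_pos hr hx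
  have h2 := one_add_mul_pos hr hy
  have h0 : 0 < 1 + r := by linarith
  have key : ∀ {z : ℝ}, z ∈ Icc (0 : ℝ) 1 → 1 + r * z ≤ 1 + |r| := fun {z} hz => by
    nlinarith [le_abs_self r, abs_nonneg r, hz.1, hz.2,
      mul_le_mul_of_nonneg_right (le_abs_self r) hz.1]
  rw [normFrac_sub hr hx hy]
  have e : (1 + |r|) ^ 2 / (1 + r) * ((1 + r) * (y - x) / ((1 + r * x) * (1 + r * y)))
      = ((1 + |r|) ^ 2 * (y - x)) / ((1 + r * x) * (1 + r * y)) := by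
    field_simp
  rw [e, le_div_iff₀ (by positivity), mul_comm]
  refine mul_le_mul_of_nonneg_right ?_ (by linarith)
  rw [sq]
  exact mul_le_mul (key hx) (key hy) h2.le (by positivity)

/-- `r ↦ normFrac r x` is injective for `0 < x < 1`. -/
lemma normFrac_ratio_inj {r s x : ℝ} (hr : -1 < r) (hs : -1 < s) (hx : x ∈ Ioo (0 : ℝ) 1)
    (h : normFrac r x = normFrac s x) : r = s := by
  have h1 := (one_add_mul_pos hr ⟨hx.1.le, hx.2.le⟩).ne'
  have h2 := (one_add_mul_pos hs ⟨hx.1.le, hx.2.le⟩).ne'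
  unfold normFrac at h
  rw [div_eq_div_iff h1 h2] at h
  -- The difference of the cross products factors completely, which is why only the end points are
  -- excluded.
  have h3 : x * (1 - x) * (r - s) = 0 := by linear_combination h
  have h4 : x * (1 - x) ≠ 0 := mul_ne_zero hx.1.ne' (by linarith [hx.2])
  linarith [(mul_eq_zero.1 h3).resolve_left h4]

namespace IsBranch

variable {A : Matrix (Fin 2) (Fin 2) ℝ}

lemma denom_pos (hA : IsBranch A) {x : ℝ} (hx : x ∈ Icc (0 : ℝ) 1) : 0 < A 1 0 * x + 1 := by
  rw [add_comm]
  exact one_add_mul_pos (by linarith [hA.c_pos]) hx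

lemma linFrac_zero (hA : IsBranch A) : linFrac A 0 = A 0 1 := by simp [linFrac, hA.d_eq]

lemma linFrac_one (hA : IsBranch A) : linFrac A 1 = (A 0 0 + A 0 1) / (A 1 0 + 1) := by
  simp [linFrac, hA.d_eq]

lemma linFrac_zero_mem (hA : IsBranch A) : linFrac A 0 ∈ Ico (0 : ℝ) 1 := by
  rw [hA.linFrac_zero]; exact ⟨hA.b_nonneg, hA.b_lt⟩

lemma linFrac_one_mem (hA : IsBranch A) : linFrac A 1 ∈ Ioc (0 : ℝ) 1 := by
  rw [hA.linFrac_one]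
  exact ⟨div_pos hA.ab_pos hA.c_pos, (div_le_one hA.c_pos).2 hA.ab_le⟩

lemma ratio_denom_pos (hA : IsBranch A) {r : ℝ} (hr : -1 < r) : 0 < A 0 1 * r + 1 := by
  rw [mul_comm, add_comm]
  exact one_add_mul_pos hr ⟨hA.b_nonneg, hA.b_lt.le⟩

/-- Since `A 1 0 + 1 ≥ A 0 0 + A 0 1 > 0`, the quantity is at least `(1 + r) * (A 0 0 + A 0 1)`. It
is the numerator of `1 + ratioMap A r`. -/
lemma ratio_aux_pos (hA : IsBranch A) {r : ℝ} (hr : -1 < r) :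
    0 < A 1 0 + 1 + r * (A 0 0 + A 0 1) := by
  nlinarith [hA.ab_le, mul_pos hA.ab_pos (by linarith : 0 < r + 1)]

lemma neg_one_lt_ratioMap (hA : IsBranch A) {r : ℝ} (hr : -1 < r) : -1 < ratioMap A r := by
  unfold ratioMap
  rw [lt_div_iff₀ (hA.ratio_denom_pos hr)]
  nlinarith [hA.ratio_aux_pos hr]

lemma normFrac_linFrac_eq (hA : IsBranch A) {r x : ℝ} (hx : x ∈ Icc (0 : ℝ) 1) :
    normFrac r (linFrac A x) = (1 + r) * (A 0 0 * x + A 0 1) /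
      (A 1 0 * x + 1 + r * (A 0 0 * x + A 0 1)) := by
  have h := (hA.denom_pos hx).ne'
  unfold normFrac linFrac
  rw [hA.d_eq, mul_div_assoc', mul_div_assoc', one_add_div h, div_div_div_cancel_right₀ h]

lemma branchProb_eq (hA : IsBranch A) {r : ℝ} (hr : -1 < r) :
    branchProb A r = (1 + r) * (A 0 0 - A 0 1 * A 1 0) /
      ((A 0 1 * r + 1) * (A 1 0 + 1 + r * (A 0 0 + A 0 1))) := by
  have h1 := (hA.ratio_denom_pos hr).ne'
  have h2 := (hA.ratio_aux_pos hr).ne'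
  unfold branchProb
  rw [hA.normFrac_linFrac_eq ⟨zero_le_one, le_rfl⟩, hA.normFrac_linFrac_eq ⟨le_rfl, zero_le_one⟩]
  have e1 : A 1 0 * 1 + 1 + r * (A 0 0 * 1 + A 0 1) = A 1 0 + 1 + r * (A 0 0 + A 0 1) := by ring
  have e2 : A 1 0 * 0 + 1 + r * (A 0 0 * 0 + A 0 1) = A 0 1 * r + 1 := by ring
  rw [e1, e2, div_sub_div _ _ h2 h1, mul_comm (A 0 1 * r + 1)]
  congr 1
  ring

lemma branchProb_pos (hA : IsBranch A) {r : ℝ} (hr : -1 < r) : 0 < branchProb A r := by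
  rw [hA.branchProb_eq hr]
  have := hA.ratio_denom_pos hr
  have := hA.ratio_aux_pos hr
  have := hA.det_pos
  have : 0 < 1 + r := by linarith
  positivity

/-- `normFrac r ∘ linFrac A` is an affine function of `normFrac (ratioMap A r)`. -/
lemma normFrac_linFrac (hA : IsBranch A) {r x : ℝ} (hr : -1 < r) (hx : x ∈ Icc (0 : ℝ) 1) :
    normFrac r (linFrac A x) =
      normFrac r (linFrac A 0) + branchProb A r * normFrac (ratioMap A r) x := by
  have h1 := (hA.ratio_denom_pos hr).ne'
  have h2 := (hA.ratio_aux_pos hr).ne'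
  have h3 := (one_add_mul_pos (hA.neg_one_lt_ratioMap hr) hx).ne'
  have e : 1 + ratioMap A r * x =
      (A 1 0 * x + 1 + r * (A 0 0 * x + A 0 1)) / (A 0 1 * r + 1) := by
    unfold ratioMap
    rw [eq_div_iff h1, add_mul, mul_right_comm, div_mul_cancel₀ _ h1]
    ring
  have h4 : A 1 0 * x + 1 + r * (A 0 0 * x + A 0 1) ≠ 0 := by
    intro h; rw [e, h, zero_div] at h3; exact h3 rfl
  have e' : normFrac (ratioMap A r) x = (A 1 0 + 1 + r * (A 0 0 + A 0 1)) * x /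
      (A 1 0 * x + 1 + r * (A 0 0 * x + A 0 1)) := by
    unfold normFrac
    rw [e]
    unfold ratioMap
    rw [one_add_div h1, div_mul_eq_mul_div, div_div_div_cancel_right₀ h1]
    congr 1
    ring
  have e0 : normFrac r (linFrac A 0) = (1 + r) * A 0 1 / (A 0 1 * r + 1) := by
    rw [hA.normFrac_linFrac_eq ⟨le_rfl, zero_le_one⟩]
    congr 1 <;> ring
  have aux : ∀ n b δ B D E : ℝ, B ≠ 0 → D ≠ 0 → E ≠ 0 → n * B = b * D + δ * x →
      (1 + r) * n / D = (1 + r) * b / B + (1 + r) * δ / (B * E) * (E * x / D) := by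
    intro n b δ B D E hB hD hE h
    field_simp
    linear_combination (1 + r) * h
  rw [hA.normFrac_linFrac_eq hx, hA.branchProb_eq hr, e', e0]
  exact aux _ _ _ _ _ _ h1 h4 h2 (by ring)

/-- Positivity of the determinant places the ratio map below its limit at infinity; the bound does
not depend on `r`. -/
lemma ratioMap_le (hA : IsBranch A) (hb : 0 < A 0 1) {r : ℝ} (hr : -1 < r) :
    ratioMap A r ≤ A 0 0 / A 0 1 := by
  unfold ratioMap
  rw [div_le_div_iff₀ (hA.ratio_denom_pos hr) hb]
  nlinarith [hA.det_pos]

lemma continuousOn_ratioMap (hA : IsBranch A) : ContinuousOn (ratioMap A) (Ioi (-1)) := by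
  unfold ratioMap
  exact ContinuousOn.div (by fun_prop) (by fun_prop) fun r hr => (hA.ratio_denom_pos hr).ne'

lemma continuousOn_branchProb (hA : IsBranch A) : ContinuousOn (branchProb A) (Ioi (-1)) := by
  have : ContinuousOn (fun r => (1 + r) * (A 0 0 - A 0 1 * A 1 0) /
      ((A 0 1 * r + 1) * (A 1 0 + 1 + r * (A 0 0 + A 0 1)))) (Ioi (-1)) :=
    ContinuousOn.div (by fun_prop) (by fun_prop) fun r hr =>
      (mul_pos (hA.ratio_denom_pos hr) (hA.ratio_aux_pos hr)).ne'
  exact this.congr fun r hr => hA.branchProb_eq hr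

end IsBranch

end DeRham

-- Admissible families, and the explicit form as a common fixed point.

namespace DeRham

section Admissible

variable {N : ℕ} {A : Fin N → Matrix (Fin 2) (Fin 2) ℝ}

/-- The end points of the images of `[0,1]` under the maps `linFrac (A i)`. -/
noncomputable def node (A : Fin N → Matrix (Fin 2) (Fin 2) ℝ) (k : ℕ) : ℝ :=
  -- The default `1` makes `node A N` the right end of the last image, so that sums over all
  -- branches telescope to `1`.
  if h : k < N then linFrac (A ⟨k, h⟩) 0 else 1

lemma node_val (i : Fin N) : node A i = linFrac (A i) 0 := by simp [node]

lemma node_self : node A N = 1 := by simp [node]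

lemma Admissible.node_zero [NeZero N] (hA : Admissible A) : node A 0 = 0 := by
  have h := NeZero.pos N
  simpa [node, h] using hA.left_end ⟨0, h⟩ rfl

lemma Admissible.node_succ (hA : Admissible A) (i : Fin N) :
    node A (i + 1) = linFrac (A i) 1 := by
  by_cases h : (i : ℕ) + 1 < N
  · simpa [node, h] using (hA.junction i ⟨i + 1, h⟩ rfl).symm
  · have : (i : ℕ) + 1 = N := by omega
    simpa [node, h] using (hA.right_end i this).symm

lemma Admissible.c_pos (hA : Admissible A) (hd : ∀ i, A i 1 1 = 1) (i : Fin N) :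
    0 < A i 1 0 + 1 := by
  have h1 := Real.sqrt_pos.2 (hA.det_pos i)
  have h2 := (hA.sqrt_det_le i).trans (min_le_right _ _)
  rw [hd] at h2
  linarith

lemma Admissible.det_pos' (hA : Admissible A) (hd : ∀ i, A i 1 1 = 1) (i : Fin N) :
    0 < A i 0 0 - A i 0 1 * A i 1 0 := by
  have h1 := hA.det_pos i
  rwa [Matrix.det_fin_two, hd, mul_one] at h1

lemma Admissible.node_lt_succ (hA : Admissible A) (hd : ∀ i, A i 1 1 = 1) (i : Fin N) :
    node A i < node A (i + 1) := by
  have h1 := hA.c_pos hd i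
  have h2 := hA.det_pos' hd i
  rw [node_val, hA.node_succ]
  simp only [linFrac, hd, mul_zero, zero_add, div_one, mul_one]
  rw [lt_div_iff₀ h1]
  linarith

lemma Admissible.node_nonneg [NeZero N] (hA : Admissible A) (hd : ∀ i, A i 1 1 = 1) (k : ℕ) :
    0 ≤ node A k := by
  induction k with
  | zero => exact hA.node_zero.ge
  | succ k ih =>
    by_cases h : k < N
    · exact ih.trans (hA.node_lt_succ hd ⟨k, h⟩).le
    · have : ¬ k + 1 < N := by omega
      simp [node, this]

lemma Admissible.node_le_one (hA : Admissible A) (hd : ∀ i, A i 1 1 = 1) (k : ℕ) :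
    node A k ≤ 1 := by
  -- Downward induction: `m` bounds the distance from `k` to `N`.
  have key : ∀ m k : ℕ, N ≤ k + m → node A k ≤ 1 := by
    intro m
    induction m with
    | zero =>
      intro k hk
      have : ¬ k < N := by omega
      simp [node, this]
    | succ m ih =>
      intro k hk
      by_cases h : k < N
      · exact (hA.node_lt_succ hd ⟨k, h⟩).le.trans (ih _ (by simp only; omega))
      · simp [node, h]
  exact key N k (by omega)

/-- The nodes increase strictly from `0` to `1`, which confines each image to `[0,1]`; the square
root condition makes the denominator positive at `1`. -/
lemma Admissible.isBranch [NeZero N] (hA : Admissible A) (hd : ∀ i, A i 1 1 = 1) (i : Fin N) :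
    IsBranch (A i) := by
  have hc := hA.c_pos hd i
  have h0 : node A i = A i 0 1 := by rw [node_val]; simp [linFrac, hd]
  have h1 : node A (i + 1) = (A i 0 0 + A i 0 1) / (A i 1 0 + 1) := by
    rw [hA.node_succ]; simp [linFrac, hd]
  have hlt := hA.node_lt_succ hd i
  have hn := hA.node_nonneg hd i
  have hl := hA.node_le_one hd (i + 1)
  refine ⟨hd i, hA.det_pos' hd i, hc, h0 ▸ hn, by linarith, ?_, ?_⟩
  · exact (div_pos_iff_of_pos_right hc).1 (h1 ▸ hn.trans_lt hlt)
  · exact (div_le_one hc).1 (h1 ▸ hl)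

lemma Admissible.branchProb_eq (hA : Admissible A) (i : Fin N) (r : ℝ) :
    branchProb (A i) r = normFrac r (node A (i + 1)) - normFrac r (node A i) := by
  rw [hA.node_succ, node_val, branchProb]

lemma sum_Iio_sub (G : ℕ → ℝ) (i : Fin N) :
    ∑ j ∈ Finset.Iio i, (G (j + 1) - G j) = G i - G 0 := by
  rw [← Finset.sum_range_sub, ← Nat.Iio_eq_range, ← Fin.map_valEmbedding_Iio, Finset.sum_map]
  rfl

lemma Admissible.sum_branchProb_Iio [NeZero N] (hA : Admissible A) (i : Fin N) (r : ℝ) :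
    ∑ j ∈ Finset.Iio i, branchProb (A j) r = normFrac r (linFrac (A i) 0) := by
  simp_rw [hA.branchProb_eq]
  rw [sum_Iio_sub (fun k => normFrac r (node A k)), hA.node_zero, node_val]
  simp

lemma Admissible.sum_branchProb [NeZero N] (hA : Admissible A) {r : ℝ} (hr : -1 < r) :
    ∑ j, branchProb (A j) r = 1 := by
  simp_rw [hA.branchProb_eq]
  rw [Fin.sum_univ_eq_sum_range (fun k => normFrac r (node A (k + 1)) - normFrac r (node A k)),
    Finset.sum_range_sub (fun k => normFrac r (node A k)), hA.node_zero, node_self,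
    normFrac_one hr, normFrac_zero, sub_zero]

lemma sum_Iic_eq (p : Fin N → ℝ) (i : Fin N) :
    ∑ j ∈ Finset.Iic i, p j = p i + ∑ j ∈ Finset.Iio i, p j := by
  rw [Finset.Iic_eq_cons_Iio, Finset.sum_cons]

lemma neg_one_lt_div {a c : ℝ} (ha : a < 1) (h : a - 1 < c) : -1 < c / (1 - a) := by
  rw [lt_div_iff₀ (by linarith)]
  linarith

variable [NeZero N]

lemma Admissible.a_zero_pos (hA : Admissible A) (hd : ∀ i, A i 1 1 = 1) : 0 < A 0 0 0 := by
  have h := hA.left_end 0 rfl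
  have h' := (hA.isBranch hd 0).det_pos
  rw [(hA.isBranch hd 0).linFrac_zero] at h
  simpa [h] using h'

lemma Admissible.b_zero (hA : Admissible A) (hd : ∀ i, A i 1 1 = 1) : A 0 0 1 = 0 := by
  rw [← (hA.isBranch hd 0).linFrac_zero, hA.left_end 0 rfl]

/-- As `b₀ = 0`, the determinant is `a₀`, and `a₀ < √a₀ ≤ c₀ + 1` because `0 < a₀ < 1`. This is what
gives `-1 < e₀ A`. -/
lemma Admissible.a_sub_one_lt_c (hA : Admissible A) (hd : ∀ i, A i 1 1 = 1) (ha : A 0 0 0 < 1) :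
    A 0 0 0 - 1 < A 0 1 0 := by
  have h2 := (hA.sqrt_det_le 0).trans (min_le_right _ _)
  have h0 := hA.a_zero_pos hd
  rw [Matrix.det_fin_two, hd, hA.b_zero hd, mul_one, zero_mul, sub_zero] at h2
  have h3 : A 0 0 0 < √(A 0 0 0) := by
    rw [Real.lt_sqrt h0.le]
    nlinarith
  linarith

lemma Admissible.neg_one_lt_e₀ (hA : Admissible A) (hd : ∀ i, A i 1 1 = 1) (ha : A 0 0 0 < 1) :
    -1 < e₀ A :=
  neg_one_lt_div ha (hA.a_sub_one_lt_c hd ha)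

/-- A common fixed point of the ratio maps yields the explicit form. -/
lemma Admissible.hasExplicitForm (hA : Admissible A) (hd : ∀ i, A i 1 1 = 1) (ha : A 0 0 0 < 1)
    {ρ : ℝ} (hρ : -1 < ρ) (h : ∀ i, ratioMap (A i) ρ = ρ) :
    HasExplicitForm A fun i => branchProb (A i) ρ := by
  -- With `b₀ = 0` the zeroth ratio map is affine, and its only fixed point is `c₀ / (1 - a₀)`.
  have he : e₀ A = ρ := by
    have h0 := h 0
    rw [ratioMap, hA.b_zero hd, zero_mul, zero_add, div_one] at h0
    have : (1 - A 0 0 0) ≠ 0 := by linarith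
    rw [e₀, div_eq_iff this]
    linarith
  intro i
  have hB := hA.isBranch hd i
  have hbr := (hB.ratio_denom_pos hρ).ne'
  have hb1 : 1 + ρ * A i 0 1 ≠ 0 := by rwa [add_comm, mul_comm]
  have hρ' : 1 + ρ ≠ 0 := by linarith
  have hfix : A i 0 0 * ρ + A i 1 0 = ρ * (A i 0 1 * ρ + 1) := by
    have := h i
    rwa [ratioMap, div_eq_iff hbr] at this
  have hc : A i 1 0 = ρ * (A i 0 1 * ρ + 1) - A i 0 0 * ρ := by linarith
  have hσ : ∑ j ∈ Finset.Iio i, branchProb (A j) ρ = (1 + ρ) * A i 0 1 / (1 + ρ * A i 0 1) := by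
    rw [hA.sum_branchProb_Iio, hB.linFrac_zero]; rfl
  have hp : branchProb (A i) ρ = (A i 0 0 - ρ * A i 0 1) / (1 + ρ * A i 0 1) := by
    have h2 := (hB.ratio_aux_pos hρ).ne'
    rw [hB.branchProb_eq hρ]
    have e : A i 1 0 + 1 + ρ * (A i 0 0 + A i 0 1) = (1 + ρ) * (1 + ρ * A i 0 1) := by
      rw [hc]; ring
    rw [e, div_eq_div_iff (mul_ne_zero hbr (mul_ne_zero hρ' hb1)) hb1, hc]
    ring
  have hD : (1 - (1 + ρ) * A i 0 1 / (1 + ρ * A i 0 1)) * ρ + 1 = (1 + ρ) / (1 + ρ * A i 0 1) := by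
    field_simp
    ring
  simp only [he, sum_Iic_eq, hσ, hp, hD]
  refine ⟨?_, ?_, ?_⟩
  · rw [eq_div_iff (div_ne_zero hρ' hb1)]
    field_simp
    ring
  · rw [eq_div_iff (div_ne_zero hρ' hb1)]
    field_simp
  · rw [eq_div_iff (div_ne_zero hρ' hb1), hc]
    field_simp
    ring

/-- The explicit form says that `e₀` is a common fixed point of the ratio maps, and that
`p i` is the corresponding increment. -/
lemma Admissible.of_hasExplicitForm (hA : Admissible A) (hd : ∀ i, A i 1 1 = 1)
    (ha : A 0 0 0 < 1) {p : Fin N → ℝ} (h : HasExplicitForm A p) (i : Fin N) :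
    ratioMap (A i) (e₀ A) = e₀ A ∧ branchProb (A i) (e₀ A) = p i := by
  have hρ := hA.neg_one_lt_e₀ hd ha
  have hB := hA.isBranch hd i
  obtain ⟨h1, h2, h3⟩ := h i
  rw [sum_Iic_eq] at h1 h3
  generalize e₀ A = ρ at *
  generalize ∑ j ∈ Finset.Iio i, p j = σ at *
  -- A vanishing denominator would give `a = b = 0` by the convention for division by zero, against
  -- `a + b > 0`.
  have hD : (1 - σ) * ρ + 1 ≠ 0 := by
    intro h0
    rw [h0, div_zero] at h1 h2
    have := hB.ab_pos
    rw [h1, h2] at this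
    simp at this
  have hρ' : 1 + ρ ≠ 0 := by linarith
  have hbr := (hB.ratio_denom_pos hρ).ne'
  have haux := (hB.ratio_aux_pos hρ).ne'
  rw [eq_div_iff hD] at h1 h2 h3
  have h4 : (A i 0 1 * ρ + 1) * ((1 - σ) * ρ + 1) = 1 + ρ := by linear_combination ρ * h2
  have hT : A i 0 0 * ρ + A i 1 0 = ρ * (A i 0 1 * ρ + 1) := by
    apply mul_right_cancel₀ hD
    linear_combination ρ * h1 + h3 - ρ * h4
  refine ⟨by rw [ratioMap, div_eq_iff hbr, hT], ?_⟩
  have e : A i 1 0 + 1 + ρ * (A i 0 0 + A i 0 1) = (1 + ρ) * (A i 0 1 * ρ + 1) := by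
    linear_combination hT
  have hc : A i 1 0 = ρ * (A i 0 1 * ρ + 1) - A i 0 0 * ρ := by linarith
  have hdet : A i 0 0 - A i 0 1 * A i 1 0 = (A i 0 1 * ρ + 1) * (A i 0 0 - A i 0 1 * ρ) := by
    rw [hc]; ring
  rw [hB.branchProb_eq hρ, e, hdet, div_eq_iff (mul_ne_zero hbr (mul_ne_zero hρ' hbr))]
  have h5 : A i 0 0 - A i 0 1 * ρ = p i * (A i 0 1 * ρ + 1) := by
    apply mul_right_cancel₀ hD
    linear_combination h1 - ρ * h2 - p i * h4
  rw [h5]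
  ring

end Admissible

end DeRham

-- Geometric decay of the Hellinger affinity.

namespace DeRham

section Affinity

variable {N : ℕ} {A : Fin N → Matrix (Fin 2) (Fin 2) ℝ} {q : Fin N → ℝ}

/-- The increment of `normFrac r` along the composition of the maps `linFrac (A i)` coded by a
word. -/
noncomputable def wordProb (A : Fin N → Matrix (Fin 2) (Fin 2) ℝ) : List (Fin N) → ℝ → ℝ
  | [], _ => 1
  | i :: w, r => branchProb (A i) r * wordProb A w (ratioMap (A i) r)

/-- The Hellinger affinity of the distributions `wordProb A · r` and `(w.map q).prod` on words
of length `n`, defined through its recursion on `n`. -/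
noncomputable def affinity (A : Fin N → Matrix (Fin 2) (Fin 2) ℝ) (q : Fin N → ℝ) : ℕ → ℝ → ℝ
  | 0, _ => 1
  | n + 1, r => ∑ i, √(branchProb (A i) r * q i) * affinity A q n (ratioMap (A i) r)

lemma wordProb_nonneg (hB : ∀ i, IsBranch (A i)) (w : List (Fin N)) {r : ℝ} (hr : -1 < r) :
    0 ≤ wordProb A w r := by
  induction w generalizing r with
  | nil => exact zero_le_one
  | cons i w ih =>
    exact mul_nonneg ((hB i).branchProb_pos hr).le (ih ((hB i).neg_one_lt_ratioMap hr))

lemma wordWeight_nonneg (hq : ∀ i, 0 < q i) (w : List (Fin N)) : 0 ≤ (w.map q).prod := by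
  apply List.prod_nonneg
  intro a ha
  obtain ⟨i, -, rfl⟩ := List.mem_map.1 ha
  exact (hq i).le

lemma sum_ofFn_succ {M : Type*} [AddCommMonoid M] (n : ℕ) (f : List (Fin N) → M) :
    ∑ w : Fin (n + 1) → Fin N, f (List.ofFn w) =
      ∑ i, ∑ w : Fin n → Fin N, f (i :: List.ofFn w) := by
  rw [← Fintype.sum_prod_type']
  symm
  refine Fintype.sum_equiv (Fin.consEquiv fun _ => Fin N) _ _ ?_
  rintro ⟨i, w⟩
  simp [Fin.consEquiv, List.ofFn_succ]

lemma affinity_eq_sum (hB : ∀ i, IsBranch (A i)) (hq : ∀ i, 0 < q i) (n : ℕ) {r : ℝ}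
    (hr : -1 < r) :
    affinity A q n r =
      ∑ w : Fin n → Fin N, √(wordProb A (List.ofFn w) r * ((List.ofFn w).map q).prod) := by
  induction n generalizing r with
  | zero => simp [affinity, wordProb]
  | succ n ih =>
    rw [sum_ofFn_succ n fun w => √(wordProb A w r * (w.map q).prod), affinity]
    refine Finset.sum_congr rfl fun i _ => ?_
    rw [ih ((hB i).neg_one_lt_ratioMap hr), Finset.mul_sum]
    refine Finset.sum_congr rfl fun w _ => ?_
    rw [← Real.sqrt_mul (mul_nonneg ((hB i).branchProb_pos hr).le (hq i).le), wordProb,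
      List.map_cons, List.prod_cons]
    congr 1
    ring

/-- Every ratio reached after `m` steps is still in the stable set `S`, so the bound for the last
`n` steps factors out. -/
lemma affinity_add_le {S : Set ℝ} (hS : ∀ i, MapsTo (ratioMap (A i)) S S) {n : ℕ} {C : ℝ}
    (hn : ∀ r ∈ S, affinity A q n r ≤ C) (m : ℕ) {r : ℝ} (hr : r ∈ S) :
    affinity A q (m + n) r ≤ affinity A q m r * C := by
  induction m generalizing r with
  | zero => simpa [affinity] using hn r hr
  | succ m ih =>
    rw [Nat.succ_add, affinity, affinity, Finset.sum_mul]
    refine Finset.sum_le_sum fun i _ => ?_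
    rw [mul_assoc]
    exact mul_le_mul_of_nonneg_left (ih (hS i hr)) (Real.sqrt_nonneg _)

lemma affinity_mul_le {S : Set ℝ} (hS : ∀ i, MapsTo (ratioMap (A i)) S S) {m : ℕ} {θ : ℝ}
    (hθ : 0 ≤ θ) (hm : ∀ r ∈ S, affinity A q m r ≤ θ) (k : ℕ) {r : ℝ} (hr : r ∈ S) :
    affinity A q (m * k) r ≤ θ ^ k := by
  induction k generalizing r with
  | zero => simp [affinity]
  | succ k ih =>
    rw [Nat.mul_succ, add_comm, pow_succ']
    exact (affinity_add_le hS (fun s hs => ih hs) m hr).trans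
      (mul_le_mul_of_nonneg_right (hm r hr) (pow_nonneg hθ k))

lemma continuousOn_affinity (hB : ∀ i, IsBranch (A i)) (n : ℕ) :
    ContinuousOn (affinity A q n) (Ioi (-1)) := by
  induction n with
  | zero => exact continuousOn_const
  | succ n ih =>
    refine continuousOn_finsetSum _ fun i _ => ContinuousOn.mul ?_ ?_
    · exact ((hB i).continuousOn_branchProb.mul continuousOn_const).sqrt
    · exact ih.comp (hB i).continuousOn_ratioMap fun r hr => (hB i).neg_one_lt_ratioMap hr

lemma sqrt_mul_eq {a b : ℝ} (ha : 0 ≤ a) (hb : 0 ≤ b) :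
    √(a * b) = (a + b) / 2 - (√a - √b) ^ 2 / 2 := by
  rw [Real.sqrt_mul ha, sub_sq, Real.sq_sqrt ha, Real.sq_sqrt hb]
  ring

/-- The affinity of two probability vectors is `1` minus half their squared Hellinger distance, of
which a single term is kept. -/
lemma affinity_one_le (hB : ∀ i, IsBranch (A i)) (hq : ∀ i, 0 < q i) (hq1 : ∑ i, q i = 1)
    {r : ℝ} (hr : -1 < r) (hP : ∑ i, branchProb (A i) r = 1) (i : Fin N) :
    affinity A q 1 r ≤ 1 - (√(branchProb (A i) r) - √(q i)) ^ 2 / 2 := by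
  have h : affinity A q 1 r = 1 - ∑ i, (√(branchProb (A i) r) - √(q i)) ^ 2 / 2 := by
    simp_rw [affinity, mul_one, fun i => sqrt_mul_eq ((hB i).branchProb_pos hr).le (hq i).le]
    rw [Finset.sum_sub_distrib, ← Finset.sum_div, Finset.sum_add_distrib, hP, hq1]
    norm_num
  rw [h]
  exact sub_le_sub_left (Finset.single_le_sum
    (f := fun i => (√(branchProb (A i) r) - √(q i)) ^ 2 / 2) (fun j _ => by positivity)
    (Finset.mem_univ i)) _

lemma affinity_one_le_one (hB : ∀ i, IsBranch (A i)) (hq : ∀ i, 0 < q i) (hq1 : ∑ i, q i = 1)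
    {r : ℝ} (hr : -1 < r) (hP : ∑ i, branchProb (A i) r = 1) (i : Fin N) :
    affinity A q 1 r ≤ 1 :=
  (affinity_one_le hB hq hq1 hr hP i).trans (by simp; positivity)

lemma affinity_one_lt_one (hB : ∀ i, IsBranch (A i)) (hq : ∀ i, 0 < q i) (hq1 : ∑ i, q i = 1)
    {r : ℝ} (hr : -1 < r) (hP : ∑ i, branchProb (A i) r = 1) (i : Fin N)
    (hne : branchProb (A i) r ≠ q i) : affinity A q 1 r < 1 := by
  refine (affinity_one_le hB hq hq1 hr hP i).trans_lt ?_
  have : √(branchProb (A i) r) - √(q i) ≠ 0 := by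
    rw [sub_ne_zero]
    intro h
    exact hne ((Real.sqrt_inj ((hB i).branchProb_pos hr).le (hq i).le).1 h)
  have := sq_pos_of_ne_zero this
  linarith

variable [NeZero N]

lemma affinity_two_le_one_step (hB : ∀ i, IsBranch (A i)) (hq : ∀ i, 0 < q i)
    (hq1 : ∑ i, q i = 1) (hP : ∀ r, -1 < r → ∑ i, branchProb (A i) r = 1) {r : ℝ}
    (hr : -1 < r) : affinity A q 2 r ≤ affinity A q 1 r := by
  have h := affinity_add_le (A := A) (q := q) (S := Ioi (-1)) (n := 1) (C := 1)
    (fun i r hr => (hB i).neg_one_lt_ratioMap hr)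
    (fun r hr => affinity_one_le_one hB hq hq1 hr (hP r hr) 0) 1 hr
  simpa using h

lemma branchProb_zero_eq (hA : Admissible A) (r : ℝ) :
    branchProb (A 0) r = normFrac r (linFrac (A 0) 1) := by
  rw [branchProb, hA.left_end 0 rfl, normFrac_zero, sub_zero]

lemma Admissible.linFrac_zero_one_mem (hA : Admissible A) (hd : ∀ i, A i 1 1 = 1) (hN : 2 ≤ N) :
    linFrac (A 0) 1 ∈ Ioo (0 : ℝ) 1 := by
  refine ⟨((hA.isBranch hd 0).linFrac_one_mem).1, ?_⟩
  have h := hA.junction 0 ⟨1, hN⟩ rfl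
  rw [h]
  exact ((hA.isBranch hd _).linFrac_zero_mem).2

/-- If the zeroth branch probability at `r` differs from `q 0`, the first step loses. Otherwise some
ratio map moves `r`, and since this probability is injective in the ratio, it differs from `q 0` at
the second step. -/
lemma Admissible.affinity_two_lt_one (hA : Admissible A) (hd : ∀ i, A i 1 1 = 1) (hN : 2 ≤ N)
    (hne : ∀ ρ, -1 < ρ → ∃ i, ratioMap (A i) ρ ≠ ρ) (hq : ∀ i, 0 < q i) (hq1 : ∑ i, q i = 1)
    {r : ℝ} (hr : -1 < r) : affinity A q 2 r < 1 := by
  have hB := hA.isBranch hd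
  have hP : ∀ r, -1 < r → ∑ i, branchProb (A i) r = 1 := fun r hr => hA.sum_branchProb hr
  by_cases h0 : branchProb (A 0) r = q 0
  · obtain ⟨i, hi⟩ := hne r hr
    have hT := (hB i).neg_one_lt_ratioMap hr
    have h1 : branchProb (A 0) (ratioMap (A i) r) ≠ q 0 := by
      rw [← h0, branchProb_zero_eq hA, branchProb_zero_eq hA]
      exact fun h => hi (normFrac_ratio_inj hT hr (hA.linFrac_zero_one_mem hd hN) h)
    refine lt_of_lt_of_le ?_ (affinity_one_le_one hB hq hq1 hr (hP r hr) 0)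
    change ∑ j, √(branchProb (A j) r * q j) * affinity A q 1 (ratioMap (A j) r) <
      ∑ j, √(branchProb (A j) r * q j) * 1
    refine Finset.sum_lt_sum (fun j _ => ?_) ⟨i, Finset.mem_univ i, ?_⟩
    · exact mul_le_mul_of_nonneg_left (affinity_one_le_one hB hq hq1
        ((hB j).neg_one_lt_ratioMap hr) (hP _ ((hB j).neg_one_lt_ratioMap hr)) 0)
        (Real.sqrt_nonneg _)
    · exact mul_lt_mul_of_pos_left (affinity_one_lt_one hB hq hq1 hT (hP _ hT) 0 h1)
        (Real.sqrt_pos.2 (mul_pos ((hB i).branchProb_pos hr) (hq i)))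
  · exact (affinity_two_le_one_step hB hq hq1 hP hr).trans_lt
      (affinity_one_lt_one hB hq hq1 hr (hP r hr) 0 h0)

/-- The two-step affinity is bounded away from `1` on bounded sets of ratios. -/
lemma Admissible.exists_affinity_two_le (hA : Admissible A) (hd : ∀ i, A i 1 1 = 1) (hN : 2 ≤ N)
    (hne : ∀ ρ, -1 < ρ → ∃ i, ratioMap (A i) ρ ≠ ρ) (hq : ∀ i, 0 < q i) (hq1 : ∑ i, q i = 1)
    (R : ℝ) : ∃ θ, 0 ≤ θ ∧ θ < 1 ∧ ∀ r ∈ Ioc (-1) R, affinity A q 2 r ≤ θ := by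
  have hB := hA.isBranch hd
  have hP : ∀ r, -1 < r → ∑ i, branchProb (A i) r = 1 := fun r hr => hA.sum_branchProb hr
  set g := linFrac (A 0) 1 with hg
  have hg01 : g ∈ Ioo (0 : ℝ) 1 := hA.linFrac_zero_one_mem hd hN
  -- For `1 + r < δ` the zeroth branch probability is at most `(1 + r) / (1 - g) ≤ q 0 / 4`. Its
  -- square root is then at most `√(q 0) / 2`, and the one-step loss is at least `q 0 / 8`. The
  -- remaining ratios form a compact interval.
  set δ := q 0 / 4 * (1 - g) with hδ
  have hδ0 : 0 < δ := mul_pos (by linarith [hq 0]) (by linarith [hg01.2])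
  have hfar : ∃ θ, θ < 1 ∧ ∀ r ∈ Icc (-1 + δ) R, affinity A q 2 r ≤ θ := by
    rcases (Icc (-1 + δ) R).eq_empty_or_nonempty with h | h
    · exact ⟨0, one_pos, by simp [h]⟩
    · have hsub : Icc (-1 + δ) R ⊆ Ioi (-1) := fun x hx => by
        have := hx.1
        simp only [mem_Ioi]; linarith
      obtain ⟨s, hs, hmax⟩ := isCompact_Icc.exists_isMaxOn h
        ((continuousOn_affinity (q := q) hB 2).mono hsub)
      exact ⟨_, hA.affinity_two_lt_one hd hN hne hq hq1 (hsub hs), fun r hr => hmax hr⟩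
  obtain ⟨θ, hθ, hle⟩ := hfar
  have hq0 : q 0 ≤ 1 := hq1 ▸ Finset.single_le_sum (fun i _ => (hq i).le) (Finset.mem_univ 0)
  refine ⟨max θ (1 - q 0 / 8), le_max_of_le_right (by linarith),
    max_lt hθ (by linarith [hq 0]), fun r hr => ?_⟩
  by_cases h : -1 + δ ≤ r
  · exact le_max_of_le_left (hle r ⟨h, hr.2⟩)
  · refine le_max_of_le_right ?_
    have hr1 : -1 < r := hr.1
    have hsmall : branchProb (A 0) r ≤ q 0 / 4 := by
      rw [branchProb_zero_eq hA, normFrac, div_le_iff₀ (one_add_mul_pos hr1 ⟨hg01.1.le, hg01.2.le⟩)]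
      have h1 : (1 + r) * g ≤ 1 + r := mul_le_of_le_one_right (by linarith) hg01.2.le
      have h2 : 1 - g ≤ 1 + r * g := by nlinarith [hg01.1]
      have h3 := mul_le_mul_of_nonneg_left h2 (by linarith [hq 0] : 0 ≤ q 0 / 4)
      linarith
    have hsq : √(branchProb (A 0) r) ≤ √(q 0) / 2 := by
      rw [Real.sqrt_le_left (by positivity), div_pow, Real.sq_sqrt (hq 0).le]
      linarith
    have h1 := affinity_two_le_one_step hB hq hq1 hP hr1
    have h2 := affinity_one_le hB hq hq1 hr1 (hP r hr1) 0
    have h3 := Real.sq_sqrt (hq 0).le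
    nlinarith [Real.sqrt_nonneg (q 0)]

/-- The ratio maps preserve some interval `(-1, R]` containing `0`. -/
lemma Admissible.exists_mapsTo_ratioMap (hA : Admissible A) (hd : ∀ i, A i 1 1 = 1)
    (ha : A 0 0 0 < 1) :
    ∃ R, 0 ≤ R ∧ ∀ i, MapsTo (ratioMap (A i)) (Ioc (-1) R) (Ioc (-1) R) := by
  have hB := hA.isBranch hd
  have hs : 0 ≤ ∑ i, |A i 0 0 / A i 0 1| := Finset.sum_nonneg fun i _ => abs_nonneg _
  -- `R` dominates `e₀ A` and every limit `a_i / b_i`; the term with `b₀ = 0` is zero by convention.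
  refine ⟨|e₀ A| + ∑ i, |A i 0 0 / A i 0 1|, by positivity, fun i r hr => ?_⟩
  refine ⟨(hB i).neg_one_lt_ratioMap hr.1, ?_⟩
  rcases eq_or_lt_of_le (hB i).b_nonneg with hb | hb
  · have hi : i = 0 := by
      by_contra hi
      have hpos : 0 < (i : ℕ) := Nat.pos_of_ne_zero fun h => hi (Fin.ext (by simpa using h))
      have h1 := hA.node_lt_succ hd ⟨i - 1, by omega⟩
      have h2 := hA.node_nonneg hd ((⟨i - 1, by omega⟩ : Fin N) : ℕ)
      have h3 : ((⟨i - 1, by omega⟩ : Fin N) : ℕ) + 1 = i := by simp only; omega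
      rw [h3, node_val i, (hB i).linFrac_zero, ← hb] at h1
      linarith
    subst hi
    have h1 : 0 < 1 - A 0 0 0 := by linarith
    have h2 : A 0 1 0 = e₀ A * (1 - A 0 0 0) := by
      rw [e₀, div_mul_cancel₀ _ h1.ne']
    have h3 := hA.a_zero_pos hd
    -- The zeroth ratio map is a convex combination of `r` and `e₀ A`, both at most `R`.
    rw [ratioMap, hA.b_zero hd, zero_mul, zero_add, div_one, h2]
    have h4 := mul_le_mul_of_nonneg_left hr.2 h3.le
    have h5 := mul_le_mul_of_nonneg_right (le_abs_self (e₀ A)) h1.le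
    nlinarith [mul_nonneg hs h1.le]
  · refine ((hB i).ratioMap_le hb hr.1).trans ((le_abs_self _).trans ?_)
    have := Finset.single_le_sum (f := fun i => |A i 0 0 / A i 0 1|)
      (fun i _ => abs_nonneg _) (Finset.mem_univ i)
    linarith [abs_nonneg (e₀ A)]

/-- The affinities tend to `0` along the even integers unless the ratio maps have a common
fixed point. -/
lemma Admissible.exists_affinity_le_pow (hA : Admissible A) (hd : ∀ i, A i 1 1 = 1) (hN : 2 ≤ N)
    (ha : A 0 0 0 < 1) (hne : ∀ ρ, -1 < ρ → ∃ i, ratioMap (A i) ρ ≠ ρ) (hq : ∀ i, 0 < q i)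
    (hq1 : ∑ i, q i = 1) : ∃ θ, 0 ≤ θ ∧ θ < 1 ∧ ∀ k, affinity A q (2 * k) 0 ≤ θ ^ k := by
  obtain ⟨R, hR, hmaps⟩ := hA.exists_mapsTo_ratioMap hd ha
  obtain ⟨θ, h0, h1, hle⟩ := hA.exists_affinity_two_le hd hN hne hq hq1 R
  exact ⟨θ, h0, h1, fun k => affinity_mul_le hmaps h0 hle k ⟨by norm_num, hR⟩⟩

end Affinity

end DeRham

-- Cylinders and distribution functions.

namespace DeRham

section Words

variable {N : ℕ} {A : Fin N → Matrix (Fin 2) (Fin 2) ℝ} {q : Fin N → ℝ} {φ : ℝ → ℝ}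
  {μ m : Measure ℝ}

/-- The composition of the maps `z ↦ (z + i) / N` coded by a word. -/
noncomputable def wordPoint : List (Fin N) → ℝ → ℝ
  | [], x => x
  | i :: w, x => (wordPoint w x + i) / N

lemma add_div_mem (i : Fin N) {x : ℝ} (hx : x ∈ Icc (0 : ℝ) 1) :
    (x + i) / N ∈ Icc (0 : ℝ) 1 := by
  have hN : (0 : ℝ) < N := Nat.cast_pos.2 i.pos
  have hi : (i : ℝ) + 1 ≤ N := by exact_mod_cast i.isLt
  have hi0 : (0 : ℝ) ≤ i := Nat.cast_nonneg _
  exact ⟨div_nonneg (by linarith [hx.1]) hN.le, (div_le_one hN).2 (by linarith [hx.2])⟩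

lemma wordPoint_mem (w : List (Fin N)) {x : ℝ} (hx : x ∈ Icc (0 : ℝ) 1) :
    wordPoint w x ∈ Icc (0 : ℝ) 1 := by
  induction w with
  | nil => exact hx
  | cons i w ih => exact add_div_mem i ih

lemma exists_Ioc_eq_add_div [NeZero N] {x : ℝ} (hx : x ∈ Ioc (0 : ℝ) 1) :
    ∃ i : Fin N, ∃ y ∈ Ioc (0 : ℝ) 1, x = (y + i) / N := by
  have hN : (0 : ℝ) < N := Nat.cast_pos.2 (NeZero.pos N)
  have h0 : 0 < N * x := mul_pos hN hx.1
  -- The ceiling minus one, rather than the floor, because cylinders are open on the left and closed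
  -- on the right.
  have hc : 0 < ⌈N * x⌉₊ := Nat.ceil_pos.2 h0
  have hc' : ⌈N * x⌉₊ ≤ N := Nat.ceil_le.2 (mul_le_of_le_one_right hN.le hx.2)
  have hcast : ((⌈N * x⌉₊ - 1 : ℕ) : ℝ) = (⌈N * x⌉₊ : ℝ) - 1 := by
    rw [Nat.cast_sub hc, Nat.cast_one]
  refine ⟨⟨⌈N * x⌉₊ - 1, by omega⟩, N * x - (⌈N * x⌉₊ - 1 : ℕ), ⟨?_, ?_⟩, ?_⟩
  · rw [hcast]
    linarith [Nat.ceil_lt_add_one h0.le]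
  · rw [hcast]
    linarith [Nat.le_ceil (N * x)]
  · rw [sub_add_cancel, mul_div_cancel_left₀ _ hN.ne']

lemma exists_Icc_eq_add_div [NeZero N] {x : ℝ} (hx : x ∈ Icc (0 : ℝ) 1) :
    ∃ i : Fin N, ∃ y ∈ Icc (0 : ℝ) 1, x = (y + i) / N := by
  rcases eq_or_lt_of_le hx.1 with rfl | h
  · exact ⟨0, 0, ⟨le_rfl, zero_le_one⟩, by simp⟩
  · obtain ⟨i, y, hy, h⟩ := exists_Ioc_eq_add_div (N := N) ⟨h, hx.2⟩
    exact ⟨i, y, ⟨hy.1.le, hy.2⟩, h⟩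

/-- The cylinders of level `n` cover `(0,1]`. -/
lemma exists_mem_cylinder [NeZero N] (n : ℕ) {x : ℝ} (hx : x ∈ Ioc (0 : ℝ) 1) :
    ∃ w : Fin n → Fin N, x ∈ Ioc (wordPoint (List.ofFn w) 0) (wordPoint (List.ofFn w) 1) := by
  induction n generalizing x with
  | zero => exact ⟨Fin.elim0, by simpa [wordPoint] using hx⟩
  | succ n ih =>
    obtain ⟨i, y, hy, rfl⟩ := exists_Ioc_eq_add_div (N := N) hx
    obtain ⟨w, hw⟩ := ih hy
    have hN : (0 : ℝ) < N := Nat.cast_pos.2 (NeZero.pos N)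
    refine ⟨Fin.cons i w, ?_⟩
    simp only [List.ofFn_succ, Fin.cons_zero, Fin.cons_succ, wordPoint]
    exact ⟨(div_lt_div_iff_of_pos_right hN).2 (by linarith [hw.1]),
      (div_le_div_iff_of_pos_right hN).2 (by linarith [hw.2])⟩

lemma measure_Ioc_eq [IsProbabilityMeasure μ] (a b : ℝ) :
    μ (Ioc a b) = ENNReal.ofReal (ProbabilityTheory.cdf μ b - ProbabilityTheory.cdf μ a) := by
  rw [← (ProbabilityTheory.cdf μ).measure_Ioc, ProbabilityTheory.measure_cdf]

lemma measure_Iic_of_neg (h : μ (Icc 0 1)ᶜ = 0) {x : ℝ} (hx : x < 0) : μ (Iic x) = 0 :=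
  measure_mono_null (t := (Icc 0 1)ᶜ) (fun _ hy h' => (hx.trans_le (h'.1.trans hy)).false) h

lemma measure_Iic_of_one_le [IsProbabilityMeasure μ] (h : μ (Icc 0 1)ᶜ = 0) {x : ℝ}
    (hx : 1 ≤ x) : μ (Iic x) = 1 := by
  rw [prob_compl_eq_zero_iff measurableSet_Icc] at h
  exact le_antisymm prob_le_one (h ▸ measure_mono fun y hy => hy.2.trans hx)

namespace IsSolution

variable [NeZero N]

lemma apply_add_div (hφ : IsSolution A φ) (i : Fin N) {x : ℝ} (hx : x ∈ Icc (0 : ℝ) 1) :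
    φ ((x + i) / N) = linFrac (A i) (φ x) := by
  have hN : (0 : ℝ) < N := Nat.cast_pos.2 (NeZero.pos N)
  rw [hφ.equation i ((x + i) / N) ⟨(div_le_div_iff_of_pos_right hN).2 (by linarith [hx.1]),
    (div_le_div_iff_of_pos_right hN).2 (by linarith [hx.2])⟩, mul_div_cancel₀ _ hN.ne',
    add_sub_cancel_right]

/-- `φ 0` is a fixed point of `linFrac (A 0)`. The other factor of the fixed point equation is
affine and positive at both `0` and `1`, so it has no zero in `[0,1]`. -/
lemma apply_zero (hφ : IsSolution A φ) (hA : Admissible A) (hd : ∀ i, A i 1 1 = 1)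
    (ha : A 0 0 0 < 1) : φ 0 = 0 := by
  have hmem := hφ.mapsTo (x := 0) ⟨le_rfl, zero_le_one⟩
  have h := hφ.apply_add_div 0 (x := 0) ⟨le_rfl, zero_le_one⟩
  simp only [Fin.val_zero, Nat.cast_zero, add_zero, zero_div] at h
  have hden := (hA.isBranch hd 0).denom_pos hmem
  rw [linFrac, hA.b_zero hd, hd, add_zero, eq_div_iff hden.ne'] at h
  have hc := hA.a_sub_one_lt_c hd ha
  have h1 : φ 0 * (A 0 1 0 * φ 0 + 1 - A 0 0 0) = 0 := by linear_combination h
  refine (mul_eq_zero.1 h1).resolve_right (ne_of_gt ?_)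
  nlinarith [mul_nonneg hmem.1 (by linarith : 0 ≤ A 0 1 0 - (A 0 0 0 - 1)), hmem.2, hmem.1,
    mul_nonneg (sub_nonneg.2 hmem.2) (by linarith : 0 ≤ 1 - A 0 0 0)]

end IsSolution

lemma HasDistributionFunction.cdf_eq (hμ : HasDistributionFunction μ φ)
    (hmaps : MapsTo φ (Icc 0 1) (Icc 0 1)) {x : ℝ} (hx : x ∈ Icc (0 : ℝ) 1) :
    ProbabilityTheory.cdf μ x = φ x := by
  have := hμ.isProbabilityMeasure
  rw [ProbabilityTheory.cdf_eq_real, Measure.real, hμ.apply_Iic x hx,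
    ENNReal.toReal_ofReal (hmaps hx).1]

lemma HasDistributionFunction.apply_one (hμ : HasDistributionFunction μ φ) : φ 1 = 1 := by
  have := hμ.isProbabilityMeasure
  have h := hμ.apply_Iic 1 ⟨zero_le_one, le_rfl⟩
  rw [measure_Iic_of_one_le hμ.carried le_rfl, eq_comm, ENNReal.ofReal_eq_one] at h
  exact h

namespace IsSelfSimilarMeasure

lemma measure_Iic (hm : IsSelfSimilarMeasure q m) (x : ℝ) :
    m (Iic x) = ∑ j : Fin N, ENNReal.ofReal (q j) * m (Iic (N * x - j)) := by
  conv_lhs => rw [hm.invariant]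
  rw [Measure.finsetSum_apply]
  refine Finset.sum_congr rfl fun j _ => ?_
  have hN : (0 : ℝ) < N := Nat.cast_pos.2 j.pos
  rw [Measure.smul_apply, smul_eq_mul, Measure.map_apply (by fun_prop) measurableSet_Iic]
  congr 2
  ext y
  simp only [mem_preimage, mem_Iic, div_le_iff₀ hN]
  constructor <;> intro h <;> linarith

/-- Only the zeroth branch sees `0`, so the mass there equals `q 0 < 1` times itself. -/
lemma measure_Iic_zero [NeZero N] (hm : IsSelfSimilarMeasure q m)
    (hq : ∀ i, q i < 1) : m (Iic 0) = 0 := by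
  have := hm.isProbabilityMeasure
  have h := hm.measure_Iic 0
  rw [Finset.sum_eq_single 0] at h
  · simp only [mul_zero, Fin.val_zero, Nat.cast_zero, sub_zero] at h
    by_contra h0
    have h1 : ENNReal.ofReal (q 0) * m (Iic 0) < 1 * m (Iic 0) :=
      ENNReal.mul_lt_mul_left h0 (measure_ne_top _ _) (by
        rw [ENNReal.ofReal_lt_one]; exact hq 0)
    rw [one_mul, ← h] at h1
    exact lt_irrefl _ h1
  · intro j _ hj
    rw [measure_Iic_of_neg hm.carried, mul_zero]
    have : (0 : ℝ) < (j : ℕ) :=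
      Nat.cast_pos.2 (Nat.pos_of_ne_zero fun h => hj (Fin.ext (by simpa using h)))
    linarith
  · simp

lemma cdf_one (hm : IsSelfSimilarMeasure q m) : ProbabilityTheory.cdf m 1 = 1 := by
  have := hm.isProbabilityMeasure
  rw [ProbabilityTheory.cdf_eq_real, Measure.real, measure_Iic_of_one_le hm.carried le_rfl,
    ENNReal.toReal_one]

lemma cdf_zero [NeZero N] (hm : IsSelfSimilarMeasure q m)
    (hq : ∀ i, q i < 1) : ProbabilityTheory.cdf m 0 = 0 := by
  have := hm.isProbabilityMeasure
  rw [ProbabilityTheory.cdf_eq_real, Measure.real, hm.measure_Iic_zero hq, ENNReal.toReal_zero]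

lemma cdf_add_div [NeZero N] (hm : IsSelfSimilarMeasure q m)
    (hq : ∀ i, q i ∈ Ioo (0 : ℝ) 1) (i : Fin N) {x : ℝ} (hx : x ∈ Icc (0 : ℝ) 1) :
    ProbabilityTheory.cdf m ((x + i) / N) =
      ∑ j ∈ Finset.Iio i, q j + q i * ProbabilityTheory.cdf m x := by
  have := hm.isProbabilityMeasure
  have hN' : (0 : ℝ) < N := Nat.cast_pos.2 (NeZero.pos N)
  rw [ProbabilityTheory.cdf_eq_real, ProbabilityTheory.cdf_eq_real, Measure.real, hm.measure_Iic,
    ENNReal.toReal_sum fun j _ => ENNReal.mul_ne_top ENNReal.ofReal_ne_top (measure_ne_top _ _)]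
  simp_rw [ENNReal.toReal_mul, fun j => ENNReal.toReal_ofReal (hq j).1.le]
  -- For `j = i + 1` and `x = 1` the argument is exactly `0`, so the absence of an atom at `0` is
  -- needed.
  have key : ∀ j ∉ Finset.Iic i, q j * (m (Iic (N * ((x + i) / N) - j))).toReal = 0 := by
    intro j hj
    have hij : i < j := by simpa using hj
    have hij' : (i : ℝ) + 1 ≤ (j : ℕ) := by exact_mod_cast hij
    rw [measure_mono_null (Iic_subset_Iic.2 ?_)
      (hm.measure_Iic_zero fun i => (hq i).2), ENNReal.toReal_zero, mul_zero]
    rw [mul_div_cancel₀ _ hN'.ne']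
    linarith [hx.2]
  rw [← Finset.sum_subset (Finset.subset_univ (Finset.Iic i)) fun j _ hj => key j hj,
    Finset.Iic_eq_cons_Iio, Finset.sum_cons, add_comm]
  congr 1
  · refine Finset.sum_congr rfl fun j hj => ?_
    have hij : j < i := by simpa using hj
    have hij' : (j : ℝ) + 1 ≤ (i : ℕ) := by exact_mod_cast hij
    rw [measure_Iic_of_one_le hm.carried, ENNReal.toReal_one, mul_one]
    rw [mul_div_cancel₀ _ hN'.ne']
    linarith [hx.1]
  · rw [mul_div_cancel₀ _ hN'.ne', add_sub_cancel_right, Measure.real]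

lemma cdf_wordPoint_sub [NeZero N] (hm : IsSelfSimilarMeasure q m)
    (hq : ∀ i, q i ∈ Ioo (0 : ℝ) 1) (w : List (Fin N)) :
    ProbabilityTheory.cdf m (wordPoint w 1) - ProbabilityTheory.cdf m (wordPoint w 0) =
      (w.map q).prod := by
  induction w with
  | nil => simp [wordPoint, hm.cdf_one, hm.cdf_zero fun i => (hq i).2]
  | cons i w ih =>
    rw [wordPoint, wordPoint, hm.cdf_add_div hq i (wordPoint_mem w ⟨zero_le_one, le_rfl⟩),
      hm.cdf_add_div hq i (wordPoint_mem w ⟨le_rfl, zero_le_one⟩), List.map_cons,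
      List.prod_cons, ← ih]
    ring

end IsSelfSimilarMeasure

/-- The `normFrac r`-increments of a solution along cylinders. -/
lemma IsSolution.normFrac_wordPoint_sub [NeZero N] (hφ : IsSolution A φ)
    (hB : ∀ i, IsBranch (A i)) (h0 : φ 0 = 0) (h1 : φ 1 = 1) (w : List (Fin N)) {r : ℝ}
    (hr : -1 < r) :
    normFrac r (φ (wordPoint w 1)) - normFrac r (φ (wordPoint w 0)) = wordProb A w r := by
  induction w generalizing r with
  | nil => simp [wordPoint, wordProb, h0, h1, normFrac_one hr]
  | cons i w ih =>
    have m1 := wordPoint_mem w (x := 1) ⟨zero_le_one, le_rfl⟩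
    have m0 := wordPoint_mem w (x := 0) ⟨le_rfl, zero_le_one⟩
    rw [wordPoint, wordPoint, hφ.apply_add_div i m1, hφ.apply_add_div i m0,
      (hB i).normFrac_linFrac hr (hφ.mapsTo m1), (hB i).normFrac_linFrac hr (hφ.mapsTo m0),
      wordProb, ← ih ((hB i).neg_one_lt_ratioMap hr)]
    ring

end Words

/-- Measures for which almost disjoint carriers exist up to arbitrarily small errors are
mutually singular. -/
lemma mutuallySingular_of_forall_exists {α : Type*} [MeasurableSpace α] {μ ν : Measure α}
    (h : ∀ ε : ENNReal, ε ≠ 0 → ∃ s, MeasurableSet s ∧ μ s ≤ ε ∧ ν sᶜ ≤ ε) : μ ⟂ₘ ν := by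
  -- Summable errors, so that Borel–Cantelli applies to both the sets and their complements.
  obtain ⟨ε, hε, hsum⟩ := ENNReal.exists_pos_sum_of_countable' one_ne_zero ℕ
  choose s hs hμ hν using fun n => h (ε n) (hε n).ne'
  have hfin : ∑' n, ε n ≠ ⊤ := (hsum.trans ENNReal.one_lt_top).ne
  have h1 : μ (Filter.limsup s Filter.atTop) = 0 :=
    measure_limsup_atTop_eq_zero (ne_top_of_le_ne_top hfin (ENNReal.tsum_le_tsum hμ))
  have h2 : ν (Filter.limsup (fun n => (s n)ᶜ) Filter.atTop) = 0 :=
    measure_limsup_atTop_eq_zero (ne_top_of_le_ne_top hfin (ENNReal.tsum_le_tsum hν))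
  refine ⟨Filter.limsup s Filter.atTop, MeasurableSet.measurableSet_limsup hs, h1,
    measure_mono_null ?_ h2⟩
  intro x hx
  rw [mem_compl_iff, Filter.mem_limsup_iff_frequently_mem] at hx
  rw [Filter.mem_limsup_iff_frequently_mem]
  exact (Filter.not_frequently.1 hx).frequently

end DeRham

-- Absolute continuity.

namespace DeRham

/-- Domination of the increments of the distribution functions implies absolute continuity. -/
lemma absolutelyContinuous_of_cdf_sub_le {μ ν : Measure ℝ} [IsProbabilityMeasure μ]
    [IsProbabilityMeasure ν] (C : NNReal)
    (h : ∀ x y, x ≤ y → ProbabilityTheory.cdf μ y - ProbabilityTheory.cdf μ x ≤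
      C * (ProbabilityTheory.cdf ν y - ProbabilityTheory.cdf ν x)) : μ ≪ ν := by
  -- Domination of increments says that `C * cdf ν - cdf μ` is monotone, so it generates a measure
  -- completing `μ` to `C • ν`.
  let H : StieltjesFunction ℝ :=
    { toFun := fun x => C * ProbabilityTheory.cdf ν x - ProbabilityTheory.cdf μ x
      mono' := fun x y hxy => by
        have := h x y hxy
        simp only
        linarith
      right_continuous' := fun x =>
        (continuousWithinAt_const.mul ((ProbabilityTheory.cdf ν).right_continuous x)).sub
          ((ProbabilityTheory.cdf μ).right_continuous x) }
  have hsum : ProbabilityTheory.cdf μ + H = C • ProbabilityTheory.cdf ν := by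
    ext x
    change ProbabilityTheory.cdf μ x +
      (C * ProbabilityTheory.cdf ν x - ProbabilityTheory.cdf μ x) = C * ProbabilityTheory.cdf ν x
    ring
  have hmeas : μ + H.measure = C • ν := by
    have h1 : (ProbabilityTheory.cdf μ + H).measure =
        (ProbabilityTheory.cdf μ).measure + H.measure := StieltjesFunction.measure_add _ _
    have h2 : (C • ProbabilityTheory.cdf ν).measure = C • (ProbabilityTheory.cdf ν).measure :=
      StieltjesFunction.measure_smul _ _
    rw [ProbabilityTheory.measure_cdf] at h1 h2
    rw [← h1, hsum, h2]
  refine (Measure.absolutelyContinuous_of_le (Measure.le_add_right le_rfl)).trans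
    (hmeas ▸ Measure.smul_absolutelyContinuous : μ + H.measure ≪ ν)

lemma cdf_eq_cdf_clamp {μ : Measure ℝ} [IsProbabilityMeasure μ] (h : μ (Icc 0 1)ᶜ = 0)
    (h0 : ProbabilityTheory.cdf μ 0 = 0) (x : ℝ) :
    ProbabilityTheory.cdf μ x = ProbabilityTheory.cdf μ (max 0 (min 1 x)) := by
  rcases le_total x 0 with hx | hx
  · have h1 : ProbabilityTheory.cdf μ x ≤ 0 := h0 ▸ (ProbabilityTheory.monotone_cdf μ) hx
    rw [max_eq_left ((min_le_right _ _).trans hx), h0]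
    exact le_antisymm h1 (ProbabilityTheory.cdf_nonneg μ x)
  · rcases le_total x 1 with hx1 | hx1
    · rw [min_eq_right hx1, max_eq_right hx]
    · rw [min_eq_left hx1, max_eq_right zero_le_one, ProbabilityTheory.cdf_eq_real,
        ProbabilityTheory.cdf_eq_real, Measure.real, Measure.real, measure_Iic_of_one_le h hx1,
        measure_Iic_of_one_le h le_rfl]

section Main

variable {N : ℕ} [NeZero N] {A : Fin N → Matrix (Fin 2) (Fin 2) ℝ} {p q : Fin N → ℝ} {φ : ℝ → ℝ}
  {μ m : Measure ℝ}

/-- Two bounded functions with the same self-affine functional equation agree. -/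
lemma eqOn_of_self_affine {σ : Fin N → ℝ} (hp : ∀ i, p i ∈ Ioo (0 : ℝ) 1) {f g : ℝ → ℝ}
    (hf : ∀ i : Fin N, ∀ x ∈ Icc (0 : ℝ) 1, f ((x + i) / N) = σ i + p i * f x)
    (hg : ∀ i : Fin N, ∀ x ∈ Icc (0 : ℝ) 1, g ((x + i) / N) = σ i + p i * g x)
    (hf1 : MapsTo f (Icc 0 1) (Icc 0 1)) (hg1 : MapsTo g (Icc 0 1) (Icc 0 1)) :
    EqOn f g (Icc 0 1) := by
  obtain ⟨j, hj⟩ := Finite.exists_max p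
  -- The offsets `σ i` cancel, so each refinement multiplies the difference by at most the largest
  -- `p j < 1`.
  have key : ∀ n : ℕ, ∀ x ∈ Icc (0 : ℝ) 1, |f x - g x| ≤ p j ^ n := by
    intro n
    induction n with
    | zero =>
      intro x hx
      rw [pow_zero, abs_le]
      constructor <;> linarith [(hf1 hx).1, (hf1 hx).2, (hg1 hx).1, (hg1 hx).2]
    | succ n ih =>
      intro x hx
      obtain ⟨i, y, hy, rfl⟩ := exists_Icc_eq_add_div (N := N) hx
      rw [hf i y hy, hg i y hy, add_sub_add_left_eq_sub, ← mul_sub, abs_mul,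
        abs_of_pos (hp i).1, pow_succ']
      exact mul_le_mul (hj i) (ih y hy) (abs_nonneg _) (hp j).1.le
  intro x hx
  have h := ge_of_tendsto' (tendsto_pow_atTop_nhds_zero_of_lt_one (hp j).1.le (hp j).2)
    fun n => key n x hx
  exact sub_eq_zero.1 (abs_nonpos_iff.1 h)

lemma absolutelyContinuous_of_hasExplicitForm (hA : Admissible A) (hd : ∀ i, A i 1 1 = 1)
    (ha : A 0 0 0 < 1) (hφ : IsSolution A φ) (hμ : HasDistributionFunction μ φ)
    (hp : ∀ i, p i ∈ Ioo (0 : ℝ) 1) (h : HasExplicitForm A p) (hm : IsSelfSimilarMeasure p m) :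
    μ ≪ m := by
  have := hμ.isProbabilityMeasure
  have := hm.isProbabilityMeasure
  have he := hA.neg_one_lt_e₀ hd ha
  have hfix := hA.of_hasExplicitForm hd ha h
  have hB := hA.isBranch hd
  have hcdf : EqOn (ProbabilityTheory.cdf m) (fun x => normFrac (e₀ A) (φ x)) (Icc 0 1) := by
    refine eqOn_of_self_affine (σ := fun i => ∑ j ∈ Finset.Iio i, p j) hp
      (fun i x hx => hm.cdf_add_div hp i hx) (fun i x hx => ?_)
      (fun x _ => ⟨ProbabilityTheory.cdf_nonneg m x, ProbabilityTheory.cdf_le_one m x⟩)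
      (fun x hx => normFrac_mem he (hφ.mapsTo hx))
    rw [hφ.apply_add_div i hx, (hB i).normFrac_linFrac he (hφ.mapsTo hx), (hfix i).1, (hfix i).2,
      ← hA.sum_branchProb_Iio]
    simp_rw [fun j => (hfix j).2]
  have hμ0 : ProbabilityTheory.cdf μ 0 = 0 := by
    rw [hμ.cdf_eq hφ.mapsTo ⟨le_rfl, zero_le_one⟩, hφ.apply_zero hA hd ha]
  have hm0 := hm.cdf_zero fun i => (hp i).2
  have hC : 0 ≤ (1 + |e₀ A|) ^ 2 / (1 + e₀ A) := div_nonneg (sq_nonneg _) (by linarith)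
  refine absolutelyContinuous_of_cdf_sub_le ⟨_, hC⟩ fun x y hxy => ?_
  have hcl : ∀ z : ℝ, max 0 (min 1 z) ∈ Icc (0 : ℝ) 1 := fun z =>
    ⟨le_max_left _ _, max_le zero_le_one (min_le_left _ _)⟩
  have hxy' : max 0 (min 1 x) ≤ max 0 (min 1 y) := max_le_max le_rfl (min_le_min le_rfl hxy)
  have hmono := (ProbabilityTheory.monotone_cdf μ) hxy'
  rw [cdf_eq_cdf_clamp hμ.carried hμ0 x, cdf_eq_cdf_clamp hμ.carried hμ0 y,
    cdf_eq_cdf_clamp hm.carried hm0 x, cdf_eq_cdf_clamp hm.carried hm0 y, hcdf (hcl x),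
    hcdf (hcl y)]
  rw [hμ.cdf_eq hφ.mapsTo (hcl x), hμ.cdf_eq hφ.mapsTo (hcl y)] at hmono ⊢
  exact sub_le_mul_normFrac_sub he (hφ.mapsTo (hcl x)) (hφ.mapsTo (hcl y)) hmono

-- Singularity and the theorem.

lemma measure_compl_Ioc {ν : Measure ℝ} [IsProbabilityMeasure ν] (h : ν (Icc 0 1)ᶜ = 0)
    (h0 : ProbabilityTheory.cdf ν 0 = 0) : ν (Ioc 0 1)ᶜ = 0 := by
  rw [prob_compl_eq_zero_iff measurableSet_Ioc, measure_Ioc_eq, h0,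
    ProbabilityTheory.cdf_eq_real, Measure.real, measure_Iic_of_one_le h le_rfl]
  simp

lemma mutuallySingular_of_no_common_fixed_point (hA : Admissible A) (hd : ∀ i, A i 1 1 = 1)
    (hN : 2 ≤ N) (ha : A 0 0 0 < 1) (hφ : IsSolution A φ) (hμ : HasDistributionFunction μ φ)
    (hne : ∀ ρ, -1 < ρ → ∃ i, ratioMap (A i) ρ ≠ ρ) (hq : ∀ i, q i ∈ Ioo (0 : ℝ) 1)
    (hq1 : ∑ i, q i = 1) (hm : IsSelfSimilarMeasure q m) : μ ⟂ₘ m := by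
  have := hμ.isProbabilityMeasure
  have := hm.isProbabilityMeasure
  have hB := hA.isBranch hd
  have hq0 : ∀ i, 0 < q i := fun i => (hq i).1
  obtain ⟨θ, h0, h1, hle⟩ := hA.exists_affinity_le_pow hd hN ha hne hq0 hq1
  have hφ0 := hφ.apply_zero hA hd ha
  have hcyl : ∀ w : List (Fin N),
      μ (Ioc (wordPoint w 0) (wordPoint w 1)) = ENNReal.ofReal (wordProb A w 0) := by
    intro w
    rw [measure_Ioc_eq, hμ.cdf_eq hφ.mapsTo (wordPoint_mem w ⟨zero_le_one, le_rfl⟩),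
      hμ.cdf_eq hφ.mapsTo (wordPoint_mem w ⟨le_rfl, zero_le_one⟩),
      ← hφ.normFrac_wordPoint_sub hB hφ0 hμ.apply_one w (by norm_num : (-1 : ℝ) < 0)]
    simp
  have hcyl' : ∀ w : List (Fin N),
      m (Ioc (wordPoint w 0) (wordPoint w 1)) = ENNReal.ofReal (w.map q).prod := fun w => by
    rw [measure_Ioc_eq, hm.cdf_wordPoint_sub hq w]
  refine mutuallySingular_of_forall_exists fun ε hε => ?_
  have hlim : Filter.Tendsto (fun k => ENNReal.ofReal (θ ^ k)) Filter.atTop (nhds 0) := by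
    simpa using ENNReal.tendsto_ofReal (tendsto_pow_atTop_nhds_zero_of_lt_one h0 h1)
  obtain ⟨k, hk⟩ := (hlim.eventually_le_const (pos_iff_ne_zero.2 hε)).exists
  have haff : ENNReal.ofReal (affinity A q (2 * k) 0) ≤ ε :=
    (ENNReal.ofReal_le_ofReal (hle k)).trans hk
  rw [affinity_eq_sum hB hq0 _ (by norm_num : (-1 : ℝ) < 0),
    ENNReal.ofReal_sum_of_nonneg fun _ _ => Real.sqrt_nonneg _] at haff
  -- Likelihood comparison: the smaller of two masses is at most their geometric mean. Hence `μ` on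
  -- the cylinders in `W` and `m` on the others are both bounded by the affinity.
  set W : Finset (Fin (2 * k) → Fin N) := Finset.univ.filter fun w =>
    wordProb A (List.ofFn w) 0 < ((List.ofFn w).map q).prod with hW
  have hsum : ∀ V : Finset (Fin (2 * k) → Fin N), ∑ w ∈ V, ENNReal.ofReal
      (√(wordProb A (List.ofFn w) 0 * ((List.ofFn w).map q).prod)) ≤ ε := fun V =>
    (Finset.sum_le_sum_of_subset (Finset.subset_univ V)).trans haff
  refine ⟨⋃ w ∈ W, Ioc (wordPoint (List.ofFn w) 0) (wordPoint (List.ofFn w) 1),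
    Finset.measurableSet_biUnion _ fun _ _ => measurableSet_Ioc, ?_, ?_⟩
  · refine (measure_biUnion_finset_le _ _).trans ((Finset.sum_le_sum fun w hw => ?_).trans (hsum W))
    rw [hcyl]
    refine ENNReal.ofReal_le_ofReal (Real.le_sqrt_of_sq_le ?_)
    rw [sq]
    exact mul_le_mul_of_nonneg_left (Finset.mem_filter.1 hw).2.le
      (wordProb_nonneg hB _ (by norm_num))
  · have hsub : (⋃ w ∈ W, Ioc (wordPoint (List.ofFn w) 0) (wordPoint (List.ofFn w) 1))ᶜ ⊆
        (Ioc (0 : ℝ) 1)ᶜ ∪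
          ⋃ w ∈ Wᶜ, Ioc (wordPoint (List.ofFn w) 0) (wordPoint (List.ofFn w) 1) := by
      intro x hx
      by_cases hx1 : x ∈ Ioc (0 : ℝ) 1
      · right
        obtain ⟨w, hw⟩ := exists_mem_cylinder (N := N) (2 * k) hx1
        have hwW : w ∉ W := fun h => hx (mem_biUnion h hw)
        exact mem_biUnion (Finset.mem_compl.2 hwW) hw
      · exact Or.inl hx1
    refine (measure_mono hsub).trans ((measure_union_le _ _).trans ?_)
    rw [measure_compl_Ioc hm.carried (hm.cdf_zero fun i => (hq i).2), zero_add]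
    refine (measure_biUnion_finset_le _ _).trans ((Finset.sum_le_sum fun w hw => ?_).trans (hsum Wᶜ))
    rw [hcyl']
    refine ENNReal.ofReal_le_ofReal (Real.le_sqrt_of_sq_le ?_)
    rw [sq]
    refine mul_le_mul_of_nonneg_right ?_ (wordWeight_nonneg hq0 _)
    simpa [hW] using hw

end Main

end DeRham

theorem mainTheorem4 {N : ℕ} [NeZero N] (hN : 2 ≤ N)
    (A : Fin N → Matrix (Fin 2) (Fin 2) ℝ) (hA : DeRham.Admissible A)
    (hd : ∀ i, A i 1 1 = 1) (ha : A 0 0 0 < 1)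
    (φ : ℝ → ℝ) (hφ : DeRham.IsSolution A φ)
    (μφ : Measure ℝ) (hμφ : DeRham.HasDistributionFunction μφ φ) :
    (∀ p : Fin N → ℝ, (∀ i, p i ∈ Ioo (0 : ℝ) 1) → DeRham.HasExplicitForm A p →
      ∑ i, p i = 1 ∧
      ∀ m : Measure ℝ, DeRham.IsSelfSimilarMeasure p m → μφ ≪ m) ∧
    ((¬ ∃ p : Fin N → ℝ, (∀ i, p i ∈ Ioo (0 : ℝ) 1) ∧ DeRham.HasExplicitForm A p) →
      ∀ q : Fin N → ℝ, (∀ i, q i ∈ Ioo (0 : ℝ) 1) → ∑ i, q i = 1 →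
      ∀ m : Measure ℝ, DeRham.IsSelfSimilarMeasure q m → μφ ⟂ₘ m) := by
  have hB := hA.isBranch hd
  refine ⟨fun p hp h => ⟨?_, fun m hm => ?_⟩, fun hno q hq hq1 m hm => ?_⟩
  · rw [← hA.sum_branchProb (hA.neg_one_lt_e₀ hd ha)]
    exact Finset.sum_congr rfl fun i _ => (hA.of_hasExplicitForm hd ha h i).2.symm
  · exact DeRham.absolutelyContinuous_of_hasExplicitForm hA hd ha hφ hμφ hp h hm
  · refine DeRham.mutuallySingular_of_no_common_fixed_point hA hd hN ha hφ hμφ ?_ hq hq1 hm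
    by_contra! hfix
    obtain ⟨ρ, hρ, hfix⟩ := hfix
    refine hno ⟨_, fun i => ⟨(hB i).branchProb_pos hρ, ?_⟩, hA.hasExplicitForm hd ha hρ hfix⟩
    -- A second branch of positive probability forces each branch probability strictly below the
    -- total `1`.
    have : Nontrivial (Fin N) := Fin.nontrivial_iff_two_le.2 hN
    obtain ⟨j, hj⟩ := exists_ne i
    have hlt := Finset.single_lt_sum (f := fun i => DeRham.branchProb (A i) ρ) hj
      (Finset.mem_univ i) (Finset.mem_univ j) ((hB j).branchProb_pos hρ)
      fun k _ _ => ((hB k).branchProb_pos hρ).le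
    rwa [hA.sum_branchProb hρ] at hlt
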